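/- A \emph{tree} is a finite nonempty tree; $|T|$ denotes its number of edges. A \emph{contraction} $T\to T'$ of trees is a map on vertices that sends the two endpoints of each edge of $T$ either to one vertex or to the two endpoints of an edge of $T'$, and for which the preimage of every vertex of $T'$ is the vertex set of a (nonempty) subtree of $T$. Let $\mathcal T$ be the category of trees and contractions, and let $\mathcal{RT}$ be the category of rooted trees (trees with a marked vertex, the root) and contractions that take the root to the root. Let $k$ be a field and let $\mathcal C$ be $\mathcal T$ or $\mathcal{RT}$. A \emph{$\mathcal C^{\mathrm{op}}$-module} is a functor from $\mathcal C^{\mathrm{op}}$ to $k$-vector spaces. For an object $R$ of $\mathcal C$, the principal projective module $P_R$ takes $T$ to the $k$-vector space with basis $\operatorname{Hom}_{\mathcal C}(T,R)$. A module is \emph{generated in degrees $\le d$} if it is isomorphic to a quotient of a finite direct sum $\bigoplus_i P_{R_i}$ with $|R_i|\le d$ for all $i$. It is \emph{$d$-small} if it is isomorphic to a subquotient of a module that is generated in degrees $\le d$. It is \emph{$d$-smallish} if it admits a filtration (indexed by $\mathbb Z$, increasing, with union $M$ and intersection $0$) whose associated graded module is $d$-small. For a tree $T$ (rooted, if $\mathcal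 C=\mathcal{RT}$), a tuple $\underline v=(v_1,\dots,v_r)$ of distinct vertices of $T$, and $\underline m=(m_1,\dots,m_r)\in\mathbb N^r$, let $T(\underline v,\underline m)$ be the tree obtained from $T$ by attaching, for each $i$, $m_i$ new edges to $v_i$, each of which has a new leaf as its other endpoint (with the same root as $T$ in the rooted case). \textbf{Theorem.} Let $M$ be a $d$-smallish $\mathcal T^{\mathrm{op}}$-module or a $d$-smallish $\mathcal{RT}^{\mathrm{op}}$-module over a field $k$. For every tree $T$ (rooted tree, in the second case) and every $r$-tuple $\underline v$ of distinct vertices of $T$, there is a polynomial $f_{M,T,\underline v}(t_1,\dots,t_r)\in\mathbb Q[t_1,\dots,t_r]$ of total degree at most $d$ such that, for all $\underline m\in\mathbb N^r$ that are sufficiently large in every coordinate, $M(T(\underline v,\underline m))$ is finite dimensional and $$\dim_k M\big(T(\underline v,\underline m)\big)=f_{M,T,\underline v}(m_1,\dots,m_r).$$ -/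

import Mathlib

open CategoryTheory CategoryTheory.Limits

universe u v

/-! ### Trees and contractions -/

/-- A finite (nonempty) tree. -/
structure FinTree where
  /-- the vertices -/
  V : Type
  finite : Finite V
  /-- the graph structure -/
  graph : SimpleGraph V
  isTree : graph.IsTree

namespace FinTree

/-- The number `|T|` of edges of a tree. -/
noncomputable def numEdges (T : FinTree) : ℕ := Nat.card T.graph.edgeSet

/-- A contraction `T → T'`, given by its map on vertices: each edge goes to an edge or to a vertex,
and the fiber over each vertex of `T'` is the vertex set of a (nonempty) subtree of `T`. -/
@[ext]
structure Contraction (T T' : FinTree) where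
  /-- the map on vertices -/
  toFun : T.V → T'.V
  map_adj : ∀ ⦃a b : T.V⦄, T.graph.Adj a b →
    toFun a = toFun b ∨ T'.graph.Adj (toFun a) (toFun b)
  fiber_connected : ∀ w : T'.V, (T.graph.induce (toFun ⁻¹' {w})).Connected

/-- A map that sends edges to edges or vertices preserves reachability. -/
theorem reachable_map {V W : Type} {G : SimpleGraph V} {H : SimpleGraph W} (f : V → W)
    (hf : ∀ ⦃a b⦄, G.Adj a b → f a = f b ∨ H.Adj (f a) (f b)) {x y : V} (h : G.Reachable x y) :
    H.Reachable (f x) (f y) := by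
  obtain ⟨p⟩ := h
  induction p with
  | nil => exact SimpleGraph.Reachable.refl _
  | cons hadj _ ih =>
    rcases hf hadj with h | h
    · rw [h]; exact ih
    · exact h.reachable.trans ih

namespace Contraction

variable {T T' T'' : FinTree}

theorem surjective (f : Contraction T T') : Function.Surjective f.toFun := fun w => by
  obtain ⟨⟨x, hx⟩⟩ := (f.fiber_connected w).nonempty
  exact ⟨x, hx⟩

/-- Contractions are surjective on edges. -/
theorem exists_adj (f : Contraction T T') {a b : T'.V} (hab : T'.graph.Adj a b) :
    ∃ x y, T.graph.Adj x y ∧ f.toFun x = a ∧ f.toFun y = b := by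
  by_contra! hno
  obtain ⟨x, rfl⟩ := f.surjective a
  obtain ⟨y, rfl⟩ := f.surjective b
  have hbr := SimpleGraph.isAcyclic_iff_forall_isBridge.1 T'.isTree.isAcyclic
    ((SimpleGraph.mem_edgeSet _).2 hab)
  refine SimpleGraph.isBridge_iff.1 hbr (reachable_map f.toFun ?_ (T.isTree.connected x y))
  intro p q hpq
  refine (f.map_adj hpq).imp_right fun h => ?_
  rw [SimpleGraph.deleteEdges_adj]
  refine ⟨h, ?_⟩
  rw [Set.mem_singleton_iff, Sym2.eq_iff]
  rintro (⟨h1, h2⟩ | ⟨h1, h2⟩)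
  · exact hno p q hpq h1 h2
  · exact hno q p hpq.symm h2 h1

/-- Any two vertices in the same fiber are connected inside each set containing that fiber. -/
theorem reachable_of_fiber_subset (f : Contraction T T') {S : Set T.V} {w : T'.V}
    (hS : f.toFun ⁻¹' {w} ⊆ S) {x y : T.V} (hx : f.toFun x = w) (hy : f.toFun y = w) :
    (T.graph.induce S).Reachable ⟨x, hS hx⟩ ⟨y, hS hy⟩ := by
  have h := (f.fiber_connected w).preconnected ⟨x, hx⟩ ⟨y, hy⟩
  exact h.map (SimpleGraph.induceHomOfLE T.graph hS).toHom

theorem preimage_connected (f : Contraction T T') (S : Set T'.V)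
    (hS : (T'.graph.induce S).Connected) :
    (T.graph.induce (f.toFun ⁻¹' S)).Connected := by
  have sub : ∀ w ∈ S, f.toFun ⁻¹' {w} ⊆ f.toFun ⁻¹' S := by
    rintro w hw x rfl
    exact hw
  have key : ∀ a b : S, (T'.graph.induce S).Walk a b → ∀ (x y : T.V) (hx : f.toFun x = a)
      (hy : f.toFun y = b), (T.graph.induce (f.toFun ⁻¹' S)).Reachable
        ⟨x, sub a a.2 hx⟩ ⟨y, sub b b.2 hy⟩ := by
    intro a b p
    induction p with
    | nil => exact fun x y hx hy => f.reachable_of_fiber_subset (sub _ (Subtype.prop _)) hx hy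
    | @cons a c b hac _ ih =>
      intro x y hx hy
      obtain ⟨x', y', hadj, hx', hy'⟩ := f.exists_adj (SimpleGraph.induce_adj.1 hac)
      have h1 := f.reachable_of_fiber_subset (sub a a.2) hx hx'
      have h2 : (T.graph.induce (f.toFun ⁻¹' S)).Adj ⟨x', sub a a.2 hx'⟩ ⟨y', sub c c.2 hy'⟩ :=
        SimpleGraph.induce_adj.2 hadj
      exact h1.trans (h2.reachable.trans (ih y' y hy' hy))
  refine (SimpleGraph.connected_iff _).2 ⟨fun x y => ?_, ?_⟩
  · obtain ⟨p⟩ := hS.preconnected ⟨f.toFun x, x.2⟩ ⟨f.toFun y, y.2⟩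
    exact key _ _ p x y rfl rfl
  · obtain ⟨w⟩ := hS.nonempty
    obtain ⟨x, hx⟩ := f.surjective w
    exact ⟨⟨x, sub w w.2 hx⟩⟩

/-- The identity contraction. -/
def id (T : FinTree) : Contraction T T where
  toFun x := x
  map_adj _ _ h := Or.inr h
  fiber_connected w := by
    refine (SimpleGraph.connected_iff _).2 ⟨?_, ⟨⟨w, rfl⟩⟩⟩
    intro x y
    have h : x = y := Subtype.ext (x.2.trans y.2.symm)
    rw [h]

/-- Composition of contractions: first `f`, then `g`. -/
def comp (f : Contraction T T') (g : Contraction T' T'') : Contraction T T'' where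
  toFun x := g.toFun (f.toFun x)
  map_adj _ _ h := by
    rcases f.map_adj h with h | h
    · exact Or.inl (by rw [h])
    · exact g.map_adj h
  fiber_connected w := f.preimage_connected _ (g.fiber_connected w)

end Contraction

/-- The category of trees and contractions. -/
instance : Category.{0} FinTree where
  Hom := Contraction
  id := Contraction.id
  comp f g := f.comp g

/-- The tree obtained from `T` by attaching, for each `i`, `m i` new leaves to the vertex `v i`:
the `m i` new leaves at `v i` are the vertices `Sum.inr ⟨i, j⟩` with `j : Fin (m i)`. -/
def sproutGraph (T : FinTree) {r : ℕ} (v : Fin r → T.V) (m : Fin r → ℕ) :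
    SimpleGraph (T.V ⊕ (Σ i : Fin r, Fin (m i))) where
  Adj
    | .inl a, .inl b => T.graph.Adj a b
    | .inl a, .inr p => a = v p.1
    | .inr p, .inl b => b = v p.1
    | .inr _, .inr _ => False
  symm := ⟨by
    rintro (a | p) (b | q) h
    · exact T.graph.adj_symm h
    · exact h
    · exact h
    · exact h⟩
  loopless := ⟨by
    rintro (a | p) h
    · exact T.graph.irrefl h
    · exact h⟩

theorem sproutGraph_isTree (T : FinTree) {r : ℕ} (v : Fin r → T.V) (m : Fin r → ℕ) :
    (T.sproutGraph v m).IsTree := by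
  have hl : ∀ a b : T.V, (T.sproutGraph v m).Reachable (.inl a) (.inl b) := fun a b =>
    reachable_map (H := T.sproutGraph v m) Sum.inl (fun _ _ h => Or.inr h)
      (T.isTree.connected a b)
  have hr : ∀ x, ∃ a, (T.sproutGraph v m).Reachable x (.inl a) := by
    rintro (a | p)
    · exact ⟨a, SimpleGraph.Reachable.refl _⟩
    · have h : (T.sproutGraph v m).Adj (.inr p) (.inl (v p.1)) := rfl
      exact ⟨v p.1, h.reachable⟩
  have hleaf : ∀ p : (Σ i : Fin r, Fin (m i)),
      ¬ ((T.sproutGraph v m).deleteEdges {s(.inl (v p.1), .inr p)}).Reachable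
        (.inl (v p.1)) (.inr p) := by
    intro p hreach
    have h := reachable_map (H := (⊥ : SimpleGraph Prop)) (fun x => x = Sum.inr p) ?_ hreach
    · simp at h
    · intro x y hxy
      left
      rw [SimpleGraph.deleteEdges_adj, Set.mem_singleton_iff] at hxy
      obtain ⟨hxy, hne⟩ := hxy
      have e1 : x ≠ Sum.inr p := by
        rintro rfl
        rcases y with b | q
        · have hb : b = v p.1 := hxy
          subst hb
          exact hne Sym2.eq_swap
        · exact hxy
      have e2 : y ≠ Sum.inr p := by
        rintro rfl
        rcases x with b | q
        · have hb : b = v p.1 := hxy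
          subst hb
          exact hne rfl
        · exact hxy
      simp [e1, e2]
  refine ⟨(SimpleGraph.connected_iff _).2 ⟨fun x y => ?_, ?_⟩, ?_⟩
  · obtain ⟨a, ha⟩ := hr x
    obtain ⟨b, hb⟩ := hr y
    exact ha.trans ((hl a b).trans hb.symm)
  · obtain ⟨a⟩ := T.isTree.connected.nonempty
    exact ⟨.inl a⟩
  · rw [SimpleGraph.isAcyclic_iff_forall_isBridge]
    intro e
    induction e with
    | _ x y =>
    intro he
    rw [SimpleGraph.mem_edgeSet] at he
    rcases x with a | p <;> rcases y with b | q
    · have hab : T.graph.Adj a b := he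
      have hbr := SimpleGraph.isAcyclic_iff_forall_isBridge.1 T.isTree.isAcyclic
        ((SimpleGraph.mem_edgeSet _).2 hab)
      rw [SimpleGraph.isBridge_iff] at hbr ⊢
      intro hreach
      refine hbr (reachable_map (Sum.elim _root_.id (fun p => v p.1)) ?_ hreach)
      rintro (c | p) (d | q) hcd <;>
        rw [SimpleGraph.deleteEdges_adj, Set.mem_singleton_iff] at hcd <;>
        obtain ⟨hcd, hne⟩ := hcd
      · right
        have hcd' : T.graph.Adj c d := hcd
        simp only [Sum.elim_inl, _root_.id, SimpleGraph.deleteEdges_adj, Set.mem_singleton_iff]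
        refine ⟨hcd', fun h => hne ?_⟩
        have := congrArg (Sym2.map (Sum.inl : T.V → T.V ⊕ (Σ i : Fin r, Fin (m i)))) h
        simpa using this
      · exact Or.inl hcd
      · exact Or.inl (Eq.symm hcd)
      · exact hcd.elim
    · have ha : a = v q.1 := he
      subst ha
      exact hleaf q
    · have hb : b = v p.1 := he
      subst hb
      rw [Sym2.eq_swap]
      exact hleaf p
    · exact he.elim

/-- The sprouted tree `T(v, m)`. -/
def sprout (T : FinTree) {r : ℕ} (v : Fin r → T.V) (m : Fin r → ℕ) : FinTree where
  V := T.V ⊕ (Σ i : Fin r, Fin (m i))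
  finite := by
    have := T.finite
    infer_instance
  graph := T.sproutGraph v m
  isTree := T.sproutGraph_isTree v m

end FinTree

/-- A rooted tree: a tree with a marked vertex. -/
structure RootedFinTree where
  tree : FinTree
  root : tree.V

namespace RootedFinTree

/-- The number of edges of a rooted tree. -/
noncomputable def numEdges (T : RootedFinTree) : ℕ := T.tree.numEdges

/-- A contraction of rooted trees takes the root to the root. -/
@[ext]
structure Contraction (T T' : RootedFinTree) extends FinTree.Contraction T.tree T'.tree where
  map_root : toFun T.root = T'.root

/-- The category of rooted trees and root-preserving contractions. -/
instance : Category.{0} RootedFinTree where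
  Hom := Contraction
  id T := ⟨FinTree.Contraction.id T.tree, rfl⟩
  comp f g := ⟨f.toContraction.comp g.toContraction,
    (congrArg g.toFun f.map_root).trans g.map_root⟩

/-- The sprouted rooted tree; the root stays where it was. -/
def sprout (T : RootedFinTree) {r : ℕ} (v : Fin r → T.tree.V) (m : Fin r → ℕ) :
    RootedFinTree where
  tree := T.tree.sprout v m
  root := Sum.inl T.root

end RootedFinTree

/-! ### Modules over a category -/

namespace CatModule

variable {C : Type v} [Category.{0} C] {k : Type u} [Ring k]

variable (k) in
/-- The principal projective module `P_x`: `P_x(y)` is the free `k`-module on `Hom(x, y)`. -/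
noncomputable def principal (x : C) : C ⥤ ModuleCat.{u} k where
  obj y := ModuleCat.of k ((x ⟶ y) →₀ k)
  map f := ModuleCat.ofHom (Finsupp.lmapDomain k k (fun g => g ≫ f))
  map_id y := by
    ext
    simp [Finsupp.lmapDomain]
  map_comp f g := by
    ext
    simp [Finsupp.lmapDomain]

/-- `M` is generated in degrees `≤ d`, with respect to the degree function `deg` on objects: it is
a quotient of a finite direct sum of principal projectives `P_x` with `deg x ≤ d`. -/
def GeneratedInDegree (deg : C → ℕ) (d : ℕ) (M : C ⥤ ModuleCat.{u} k) : Prop :=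
  ∃ (n : ℕ) (x : Fin n → C), (∀ i, deg (x i) ≤ d) ∧
    ∃ π : (∐ fun i => principal k (x i)) ⟶ M, Epi π

/-- `M` is `d`-small: a subquotient of a module that is generated in degrees `≤ d`. -/
def IsSmall (deg : C → ℕ) (d : ℕ) (M : C ⥤ ModuleCat.{u} k) : Prop :=
  ∃ N S : C ⥤ ModuleCat.{u} k, GeneratedInDegree deg d N ∧
    ∃ (ι : S ⟶ N) (π : S ⟶ M), Mono ι ∧ Epi π

/-- An increasing, exhaustive and separated filtration `⋯ ⊆ F (i - 1) ⊆ F i ⊆ ⋯` of `M` by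
submodules, indexed by the integers. (Finite filtrations are those that are constant outside a
bounded range of indices.) -/
structure Filtration (M : C ⥤ ModuleCat.{u} k) where
  F : ℤ → ∀ x : C, Submodule k (M.obj x)
  map_mem : ∀ (i : ℤ) {x y : C} (f : x ⟶ y), ∀ a ∈ F i x, (M.map f).hom a ∈ F i y
  mono : ∀ x : C, Monotone fun i => F i x
  exhaustive : ∀ x : C, ⨆ i, F i x = ⊤
  separated : ∀ x : C, ⨅ i, F i x = ⊥

namespace Filtration

variable {M : C ⥤ ModuleCat.{u} k} (Φ : Filtration M)

/-- The value at `x` of the `i`-th graded piece, `F i x / F (i - 1) x`. -/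
abbrev piece (i : ℤ) (x : C) : Type u :=
  Φ.F i x ⧸ (Φ.F (i - 1) x).submoduleOf (Φ.F i x)

/-- The map induced by a morphism on the `i`-th graded piece. -/
def pieceMap (i : ℤ) {x y : C} (f : x ⟶ y) : Φ.piece i x →ₗ[k] Φ.piece i y :=
  Submodule.mapQ _ _ ((M.map f).hom.restrict (Φ.map_mem i f))
    (fun a ha => Φ.map_mem (i - 1) f a ha)

open scoped DirectSum in
/-- The associated graded module, `x ↦ ⨁ i, F i x / F (i - 1) x`. -/
noncomputable def gr : C ⥤ ModuleCat.{u} k where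
  obj x := ModuleCat.of k (⨁ i : ℤ, Φ.piece i x)
  map f := ModuleCat.ofHom (DirectSum.lmap fun i => Φ.pieceMap i f)
  map_id x := by
    have h : (fun i => Φ.pieceMap i (𝟙 x)) = fun i => LinearMap.id := by
      funext i
      refine Submodule.linearMap_qext _ (LinearMap.ext fun a => ?_)
      simp [pieceMap, LinearMap.restrict_apply]
    rw [h, DirectSum.lmap_id]
    rfl
  map_comp {x y z} f g := by
    have h : (fun i => Φ.pieceMap i (f ≫ g)) =
        fun i => (Φ.pieceMap i g).comp (Φ.pieceMap i f) := by
      funext i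
      refine Submodule.linearMap_qext _ (LinearMap.ext fun a => ?_)
      simp [pieceMap, LinearMap.restrict_apply]
      rfl
    rw [h, DirectSum.lmap_comp]
    rfl

end Filtration

/-- `M` is `d`-smallish: it has a filtration whose associated graded module is `d`-small. -/
def IsSmallish (deg : C → ℕ) (d : ℕ) (M : C ⥤ ModuleCat.{u} k) : Prop :=
  ∃ Φ : Filtration M, IsSmall deg d Φ.gr

end CatModule

/-!
Fix `T` and `v`. An `r`-tuple `φ` of strictly increasing maps `Fin (m i) → Fin (m' i)` gives a
contraction `T(v, m') → T(v, m)`, which keeps the leaves at the positions in the image of `φ` and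
contracts the others into the vertices that carry them. So a module `M` restricts to a family
`m ↦ M (T(v, m))` of vector spaces with transition maps in the direction of growing `m`.

A contraction `T(v, m) → R` is given by its restriction to `T` together with, for each `i`, the word
of length `m i` of the images of the leaves at `v i`; write the letter `0` for a leaf that goes to
the image of `v i`. A leaf with a nonzero letter is alone in its fiber
(`FinTree.Contraction.eq_of_ne`), so at most `|R|` letters are nonzero
(`FinTree.Contraction.sum_card_le`), and the transition maps act by inserting zeros. The structure
`WordModel` records this situation, and the rest of the argument uses nothing else about trees.

By the filtration argument `finrank_eq_finrank_graded` and by `CatModule.IsSmall.exists_submodules`,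
it suffices to consider subspaces `S m` of the spaces with bases `B m` (the words with a base) that
are closed under insertion of zeros. Order words lexicographically. Insertion of zeros at fixed
positions is then strictly increasing (`WordModel.key_push_lt`), so the leading basis vectors of the
`S m` are closed under insertion of zeros, and their number is the dimension of `S m`
(`finrank_eq_ncard_leadingSet`). Finally, a word with `n i` given nonzero letters amounts to the
vector of the lengths of its `n i + 1` gaps, and insertion of zeros increases these lengths. Hence
the leading basis vectors form finitely many upper sets in `∏ i, ℕ ^ (n i + 1)`, with
`∑ i, n i ≤ d`; that is, monomial ideals. Their multigraded Hilbert functions are eventually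
polynomials of degree at most `∑ i, n i`, by Dickson's lemma and inclusion and exclusion
(`eventuallyPolynomial_isUpperSet`).
-/

/-! ### Leading basis vectors and dimension counts -/

section LeadingTerms

variable {k : Type u} [Field k] {B B' : Type} [LinearOrder B] [LinearOrder B']

/-- The leading basis vectors of the elements of a subspace `W` of the free vector space on a
linearly ordered set `B`: those `b` that are the largest element of the support of some `w ∈ W`. -/
def leadingSet (W : Submodule k (B →₀ k)) : Set B :=
  {b | ∃ w ∈ W, w b ≠ 0 ∧ ∀ c, b < c → w c = 0}

theorem exists_leading {w : B →₀ k} (hw : w ≠ 0) : ∃ b, w b ≠ 0 ∧ ∀ c, b < c → w c = 0 := by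
  have hne : w.support.Nonempty := Finsupp.support_nonempty_iff.2 hw
  refine ⟨w.support.max' hne, Finsupp.mem_support_iff.1 (w.support.max'_mem hne), fun c hc => ?_⟩
  by_contra h
  exact absurd (w.support.le_max' c (Finsupp.mem_support_iff.2 h)) (not_le.2 hc)

/-- The dimension of a subspace is the number of its leading basis vectors. -/
theorem finrank_eq_ncard_leadingSet [Finite B] (W : Submodule k (B →₀ k)) :
    Module.finrank k W = (leadingSet W).ncard := by
  classical
  have := Fintype.ofFinite B
  have := Fintype.ofFinite (leadingSet W)
  rw [← Nat.card_coe_set_eq, Nat.card_eq_fintype_card]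
  apply le_antisymm
  · -- the coordinates at the leading basis vectors determine an element of `W`
    let f : W →ₗ[k] (leadingSet W → k) :=
      LinearMap.pi fun b => (Finsupp.lapply b.1).comp W.subtype
    have hf : Function.Injective f := by
      rw [injective_iff_map_eq_zero]
      intro w hw
      by_contra hne
      have hne' : (w : B →₀ k) ≠ 0 := fun h => hne (Subtype.ext h)
      obtain ⟨b, hb, hlt⟩ := exists_leading hne'
      exact hb (congrFun hw ⟨b, w, w.2, hb, hlt⟩)
    simpa using LinearMap.finrank_le_finrank_of_injective hf
  · -- a choice of elements with the given leading basis vectors is linearly independent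
    choose w hw hb hlt using fun b : leadingSet W => b.2
    have hli : LinearIndependent k w := by
      rw [Fintype.linearIndependent_iff]
      intro g hg
      by_contra! hne
      obtain ⟨b₀, hb₀⟩ := hne
      obtain ⟨b, hbm, hmax⟩ := (Finset.univ.filter fun b => g b ≠ 0).exists_max_image
        (fun b : leadingSet W => b.1) ⟨b₀, by simpa using hb₀⟩
      have h0 := DFunLike.congr_fun hg b.1
      simp only [Finsupp.coe_finsetSum, Finset.sum_apply, Finsupp.smul_apply, smul_eq_mul,
        Finsupp.coe_zero, Pi.zero_apply] at h0
      rw [Finset.sum_eq_single b] at h0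
      · exact (mul_ne_zero (by simpa using hbm) (hb b)) h0
      · intro c _ hcb
        by_cases hc : g c = 0
        · simp [hc]
        · have hle := hmax c (by simpa using hc)
          rw [hlt c b.1 (lt_of_le_of_ne hle fun h => hcb (Subtype.ext h)), mul_zero]
      · simp
    have hli' : LinearIndependent k (fun b : leadingSet W => (⟨w b, hw b⟩ : W)) :=
      LinearIndependent.of_comp W.subtype hli
    exact hli'.fintype_card_le_finrank

/-- A strictly increasing map of the index sets preserves leading basis vectors. -/
theorem map_mem_leadingSet {W : Submodule k (B →₀ k)} {W' : Submodule k (B' →₀ k)} {φ : B → B'}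
    (hφ : StrictMono φ) (hW : ∀ w ∈ W, Finsupp.mapDomain φ w ∈ W') {b : B}
    (hb : b ∈ leadingSet W) : φ b ∈ leadingSet W' := by
  obtain ⟨w, hw, hwb, hlt⟩ := hb
  refine ⟨_, hW w hw, ?_, fun c hc => ?_⟩
  · rwa [Finsupp.mapDomain_apply hφ.injective]
  · by_cases h : c ∈ Set.range φ
    · obtain ⟨c, rfl⟩ := h
      rw [Finsupp.mapDomain_apply hφ.injective]
      exact hlt c (hφ.lt_iff_lt.1 hc)
    · exact Finsupp.mapDomain_of_notMem_range _ _ h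

end LeadingTerms

section Dimensions

variable {k : Type u} [Field k]

theorem finrank_comap_of_surjective {V W : Type*} [AddCommGroup V] [Module k V] [AddCommGroup W]
    [Module k W] [Module.Finite k V] {f : V →ₗ[k] W} (hf : Function.Surjective f)
    (U : Submodule k W) :
    Module.finrank k (U.comap f) = Module.finrank k U + Module.finrank k (LinearMap.ker f) := by
  let g : U.comap f →ₗ[k] U := f.restrict fun x hx => hx
  have hg : Function.Surjective g := by
    rintro ⟨y, hy⟩
    obtain ⟨x, rfl⟩ := hf y
    exact ⟨⟨x, hy⟩, rfl⟩
  have h := LinearMap.finrank_range_add_finrank_ker g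
  rw [LinearMap.range_eq_top.2 hg, finrank_top] at h
  have hk : Module.finrank k (LinearMap.ker g) = Module.finrank k (LinearMap.ker f) := by
    have hker : LinearMap.ker g = (LinearMap.ker f).submoduleOf (U.comap f) := by
      ext x
      rw [LinearMap.mem_ker, ← Subtype.coe_inj]
      exact Iff.rfl
    rw [hker]
    refine (Submodule.submoduleOfEquivOfLe fun x hx => ?_).finrank_eq
    rw [Submodule.mem_comap, LinearMap.mem_ker.1 hx]
    exact U.zero_mem
  rw [← h, hk]

open scoped DirectSum in
/-- A space with an increasing, exhaustive and separated filtration has the dimension of its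
associated graded space, if the latter is finite dimensional. -/
theorem finrank_eq_finrank_graded {V : Type*} [AddCommGroup V] [Module k V]
    (F : ℤ → Submodule k V) (hmono : Monotone F) (htop : ⨆ i, F i = ⊤) (hbot : ⨅ i, F i = ⊥)
    [Module.Finite k (⨁ i : ℤ, F i ⧸ (F (i - 1)).submoduleOf (F i))] :
    Module.Finite k V ∧ Module.finrank k V =
      Module.finrank k (⨁ i : ℤ, F i ⧸ (F (i - 1)).submoduleOf (F i)) := by
  classical
  set P : ℤ → Type _ := fun i => F i ⧸ (F (i - 1)).submoduleOf (F i)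
  -- all but finitely many pieces vanish
  obtain ⟨s, hs⟩ : ∃ s : Finset ℤ, ∀ x : ⨁ i, P i, ∀ i ∉ s, x i = 0 := by
    obtain ⟨G, hG⟩ := Module.Finite.fg_top (R := k) (M := ⨁ i, P i)
    refine ⟨G.biUnion fun g => DFinsupp.support g, fun x i hi => ?_⟩
    have hx : x ∈ Submodule.span k (G : Set (⨁ i, P i)) := hG ▸ Submodule.mem_top
    have hle : Submodule.span k (G : Set (⨁ i, P i)) ≤
        LinearMap.ker (DirectSum.component k ℤ P i) := by
      rw [Submodule.span_le]
      intro g hg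
      by_contra h
      exact hi (Finset.mem_biUnion.2 ⟨g, hg, DFinsupp.mem_support_iff.2 h⟩)
    exact hle hx
  have hzero : ∀ i ∉ s, ∀ y : P i, y = 0 := fun i hi y => by
    have := hs (DirectSum.of P i y) i hi
    rwa [DirectSum.of_eq_same] at this
  have hstep : ∀ i ∉ s, F i = F (i - 1) := fun i hi => by
    refine le_antisymm (fun x hx => ?_) (hmono (by lia))
    exact (Submodule.Quotient.mk_eq_zero ((F (i - 1)).submoduleOf (F i)) (x := ⟨x, hx⟩)).1
      (hzero i hi _)
  have hfin : ∀ i, Module.Finite k (P i) := fun i =>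
    Module.Finite.of_surjective (DirectSum.component k ℤ P i) fun y =>
      ⟨DirectSum.lof k ℤ P i y, DirectSum.component.lof_self k i y⟩
  have hsum : Module.finrank k (⨁ i, P i) = ∑ i ∈ s, Module.finrank k (P i) := by
    have e : (⨁ i, P i) ≃ₗ[k] ((i : s) → P i) := by
      refine LinearEquiv.ofBijective
        (LinearMap.pi fun i : s => DirectSum.component k ℤ P i) ⟨?_, fun y => ?_⟩
      · rw [injective_iff_map_eq_zero]
        intro x hx
        refine DFinsupp.ext fun i => ?_
        by_cases hi : i ∈ s
        · exact congrFun hx ⟨i, hi⟩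
        · exact hs x i hi
      · refine ⟨∑ i : s, DirectSum.lof k ℤ P i (y i), funext fun j => ?_⟩
        simp only [LinearMap.pi_apply, map_sum]
        rw [Finset.sum_eq_single j]
        · exact DirectSum.component.lof_self k _ _
        · intro i _ hij
          rw [DirectSum.component.of]
          exact dif_neg fun h => hij (Subtype.ext h)
        · simp
    rw [e.finrank_eq, Module.finrank_pi_fintype, Finset.sum_coe_sort s fun i => Module.finrank k (P i)]
  obtain ⟨n, hn⟩ : ∃ n : ℕ, ∀ i ∈ s, -(n : ℤ) < i ∧ i ≤ n := by
    refine ⟨s.sup Int.natAbs + 1, fun i hi => ?_⟩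
    have := Finset.le_sup (f := Int.natAbs) hi
    lia
  -- so the filtration is constant below `-n` and above `n`, with values `⊥` and `⊤`
  have hlow : ∀ j : ℕ, F (-(n : ℤ) - j) = F (-n) := fun j => by
    induction j with
    | zero => simp
    | succ j ih =>
      rw [← ih, hstep (-(n : ℤ) - j) fun h => by have := hn _ h; lia]
      congr 1
      push_cast
      ring
  have hhigh : ∀ j : ℕ, F ((n : ℤ) + j) = F n := fun j => by
    induction j with
    | zero => simp
    | succ j ih =>
      rw [← ih, hstep ((n : ℤ) + (j + 1 : ℕ)) fun h => by have := hn _ h; lia]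
      congr 1
      push_cast
      ring
  have hFbot : F (-n) = ⊥ := by
    rw [eq_bot_iff, ← hbot]
    refine le_iInf fun i => ?_
    rw [← hlow (-(n : ℤ) - i).toNat]
    exact hmono (by lia)
  have hFtop : F n = ⊤ := by
    rw [eq_top_iff, ← htop]
    refine iSup_le fun i => ?_
    rw [← hhigh (i - n).toNat]
    exact hmono (by lia)
  have hind : ∀ j : ℕ, Module.Finite k (F (-(n : ℤ) + j)) ∧ Module.finrank k (F (-(n : ℤ) + j)) =
      ∑ i ∈ Finset.Ioc (-(n : ℤ)) (-n + j), Module.finrank k (P i) := fun j => by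
    induction j with
    | zero =>
      rw [Nat.cast_zero, add_zero, hFbot]
      exact ⟨inferInstance, by simp⟩
    | succ j ih =>
      obtain ⟨ih1, ih2⟩ := ih
      have hj : (-(n : ℤ) + (j + 1 : ℕ)) - 1 = -n + j := by push_cast; ring
      have hle : F (-(n : ℤ) + j) ≤ F (-(n : ℤ) + (j + 1 : ℕ)) := hmono (by push_cast; lia)
      have hIoc : Finset.Ioc (-(n : ℤ)) (-n + (j + 1 : ℕ)) =
          insert (-(n : ℤ) + (j + 1 : ℕ)) (Finset.Ioc (-(n : ℤ)) (-n + j)) := by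
        ext i
        simp only [Finset.mem_Ioc, Finset.mem_insert]
        lia
      have h1 := hfin (-(n : ℤ) + (j + 1 : ℕ))
      rw [hIoc, Finset.sum_insert (by simp), ← ih2]
      simp only [P] at h1 ⊢
      rw [hj] at h1 ⊢
      have e := Submodule.submoduleOfEquivOfLe hle
      have := Module.Finite.equiv e.symm
      have hF : Module.Finite k (F (-(n : ℤ) + (j + 1 : ℕ))) :=
        Module.Finite.of_submodule_quotient ((F (-(n : ℤ) + j)).submoduleOf _)
      refine ⟨hF, ?_⟩
      rw [← e.finrank_eq, Submodule.finrank_quotient_add_finrank]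
  obtain ⟨h1, h2⟩ := hind (2 * n)
  have hn' : -(n : ℤ) + (2 * n : ℕ) = n := by push_cast; ring
  rw [hn'] at h1 h2
  rw [hFtop] at h1 h2
  refine ⟨Module.Finite.equiv (Submodule.topEquiv (R := k) (M := V)), ?_⟩
  rw [hsum, ← finrank_top k V, h2]
  refine (Finset.sum_subset (fun i hi => Finset.mem_Ioc.2 (hn i hi)) fun i _ hi => ?_).symm
  have : Subsingleton (P i) := ⟨fun x y => (hzero i hi x).trans (hzero i hi y).symm⟩
  exact Module.finrank_zero_of_subsingleton

end Dimensions

/-! ### Eventually polynomial functions and monomial ideals -/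

/-- `F` agrees with a rational polynomial of total degree at most `d` at all tuples whose entries
are all sufficiently large. -/
def EventuallyPolynomial {r : ℕ} (d : ℕ) (F : (Fin r → ℕ) → ℚ) : Prop :=
  ∃ f : MvPolynomial (Fin r) ℚ, f.totalDegree ≤ d ∧
    ∃ N : ℕ, ∀ m : Fin r → ℕ, (∀ i, N ≤ m i) → F m = MvPolynomial.eval (fun i => (m i : ℚ)) f

namespace EventuallyPolynomial

variable {r d d' : ℕ} {F G : (Fin r → ℕ) → ℚ}

theorem mono (h : d ≤ d') (hF : EventuallyPolynomial d F) : EventuallyPolynomial d' F :=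
  let ⟨f, hf, N, hN⟩ := hF
  ⟨f, hf.trans h, N, hN⟩

theorem congr (hF : EventuallyPolynomial d F) (h : ∀ m, F m = G m) :
    EventuallyPolynomial d G :=
  (funext h : F = G) ▸ hF

theorem zero : EventuallyPolynomial d (fun _ : Fin r → ℕ => 0) :=
  ⟨0, by simp, 0, by simp⟩

theorem add (hF : EventuallyPolynomial d F) (hG : EventuallyPolynomial d G) :
    EventuallyPolynomial d (fun m => F m + G m) := by
  obtain ⟨f, hf, N, hN⟩ := hF
  obtain ⟨g, hg, N', hN'⟩ := hG
  refine ⟨f + g, (MvPolynomial.totalDegree_add f g).trans (max_le hf hg), max N N', fun m hm => ?_⟩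
  simp only [map_add]
  rw [hN m fun i => (le_max_left _ _).trans (hm i),
    hN' m fun i => (le_max_right _ _).trans (hm i)]

theorem sub (hF : EventuallyPolynomial d F) (hG : EventuallyPolynomial d G) :
    EventuallyPolynomial d (fun m => F m - G m) := by
  obtain ⟨f, hf, N, hN⟩ := hF
  obtain ⟨g, hg, N', hN'⟩ := hG
  refine ⟨f - g, (MvPolynomial.totalDegree_sub f g).trans (max_le hf hg), max N N', fun m hm => ?_⟩
  simp only [map_sub]
  rw [hN m fun i => (le_max_left _ _).trans (hm i),
    hN' m fun i => (le_max_right _ _).trans (hm i)]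

theorem sum {ι : Type*} (s : Finset ι) {F : ι → (Fin r → ℕ) → ℚ}
    (h : ∀ x ∈ s, EventuallyPolynomial d (F x)) :
    EventuallyPolynomial d (fun m => ∑ x ∈ s, F x m) := by
  classical
  induction s using Finset.induction_on with
  | empty => simpa using zero
  | insert a s ha ih =>
    simp only [Finset.sum_insert ha]
    exact (h a (Finset.mem_insert_self a s)).add (ih fun x hx => h x (Finset.mem_insert_of_mem hx))

/-- A product of binomial coefficients `(m i - c i choose n i)` is eventually a polynomial. -/
theorem prod_choose (n c : Fin r → ℕ) :
    EventuallyPolynomial (∑ i, n i) (fun m => ∏ i, ((m i - (n i + c i) + n i).choose (n i) : ℚ)) := by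
  refine ⟨∏ i, Polynomial.aeval (MvPolynomial.X i) (Polynomial.preHilbertPoly ℚ (n i) (n i + c i)),
    (MvPolynomial.totalDegree_finsetProd _ _).trans (Finset.sum_le_sum fun i _ => ?_),
    Finset.univ.sup (fun i => n i + c i), fun m hm => ?_⟩
  · rw [Polynomial.aeval_eq_sum_range]
    refine MvPolynomial.totalDegree_finsetSum_le fun j hj => ?_
    refine (MvPolynomial.totalDegree_smul_le _ _).trans ?_
    rw [MvPolynomial.totalDegree_X_pow]
    rw [Polynomial.natDegree_preHilbertPoly, Finset.mem_range] at hj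
    lia
  · rw [map_prod]
    refine Finset.prod_congr rfl fun i _ => ?_
    have hi : n i + c i ≤ m i :=
      (Finset.le_sup (f := fun i => n i + c i) (Finset.mem_univ i)).trans (hm i)
    rw [← Polynomial.preHilbertPoly_eq_choose_sub_add ℚ (n i) hi, Polynomial.aeval_def,
      Polynomial.hom_eval₂, MvPolynomial.eval_X]
    exact congrArg (fun g => Polynomial.eval₂ g (m i : ℚ) _) (Subsingleton.elim (RingHom.id ℚ) _)

end EventuallyPolynomial

section GapVectors

variable {r : ℕ} (n : Fin r → ℕ)

/-- The gap vectors of multidegree `m`. The words of length `m i` with `n i` nonzero letters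
correspond to the vectors `a i` of lengths of the `n i + 1` gaps, so that
`n i + ∑ j, a i j = m i`. -/
def gapVectors (m : Fin r → ℕ) : Set (∀ i, Fin (n i + 1) → ℕ) :=
  {a | ∀ i, n i + ∑ j, a i j = m i}

theorem finite_gapVectors (m : Fin r → ℕ) : (gapVectors n m).Finite := by
  refine (Set.finite_Icc (0 : ∀ i, Fin (n i + 1) → ℕ) fun i _ => m i).subset fun a ha => ?_
  refine ⟨fun i j => Nat.zero_le _, fun i j => ?_⟩
  have h1 := Finset.single_le_sum (f := a i) (fun _ _ => Nat.zero_le _) (Finset.mem_univ j)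
  have h2 := ha i
  exact h1.trans (by lia)

theorem ncard_sum_eq (n s : ℕ) : {b : Fin (n + 1) → ℕ | ∑ j, b j = s}.ncard = (s + n).choose n := by
  rw [← Nat.card_coe_set_eq]
  have e := Nat.card_congr (Sym.equivNatSumOfFintype (Fin (n + 1)) s)
  refine e.symm.trans ?_
  rw [Nat.card_eq_fintype_card, Sym.card_sym_eq_choose, Fintype.card_fin,
    show n + 1 + s - 1 = s + n by lia]
  exact Nat.choose_symm_add

/-- The number of gap vectors above a given one, by stars and bars. -/
theorem ncard_gapVectors_Ici (g : ∀ i, Fin (n i + 1) → ℕ) (m : Fin r → ℕ)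
    (hm : ∀ i, n i + ∑ j, g i j ≤ m i) :
    (Set.Ici g ∩ gapVectors n m).ncard =
      ∏ i, (m i - (n i + ∑ j, g i j) + n i).choose (n i) := by
  have h : Set.Ici g ∩ gapVectors n m = (fun b => g + b) ''
      Set.univ.pi fun i => {b : Fin (n i + 1) → ℕ | ∑ j, b j = m i - (n i + ∑ j, g i j)} := by
    ext a
    simp only [Set.mem_inter_iff, Set.mem_Ici, gapVectors, Set.mem_ofPred_eq, Set.mem_image,
      Set.mem_pi, Set.mem_univ, true_imp_iff]
    constructor
    · rintro ⟨hga, ha⟩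
      refine ⟨a - g, fun i => ?_, add_tsub_cancel_of_le hga⟩
      have h1 : ∑ j, a i j = ∑ j, g i j + ∑ j, (a - g) i j := by
        rw [← Finset.sum_add_distrib]
        exact Finset.sum_congr rfl fun j _ => (add_tsub_cancel_of_le (hga i j)).symm
      have h2 := ha i
      lia
    · rintro ⟨b, hb, rfl⟩
      refine ⟨le_self_add, fun i => ?_⟩
      have h1 : ∑ j, (g + b) i j = ∑ j, g i j + ∑ j, b i j := Finset.sum_add_distrib
      have h2 := hb i
      have h3 := hm i
      lia
  rw [h, Set.ncard_image_of_injective _ (add_right_injective g), ← Nat.card_coe_set_eq,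
    Nat.card_congr (Equiv.Set.univPi _), Nat.card_pi]
  exact Finset.prod_congr rfl fun i _ => (Nat.card_coe_set_eq _).trans (ncard_sum_eq _ _)

/-- Inclusion and exclusion, one generator `g` at a time: the intersection of the upper sets
generated by `g` and by `G` is generated by the suprema `g ⊔ x` with `x ∈ G`, which are not more
numerous than the elements of `G`. -/
theorem eventuallyPolynomial_upperClosure (G : Finset (∀ i, Fin (n i + 1) → ℕ)) :
    EventuallyPolynomial (∑ i, n i) fun m =>
      ((((upperClosure (G : Set (∀ i, Fin (n i + 1) → ℕ)) : Set _) ∩ gapVectors n m).ncard : ℕ) :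
        ℚ) := by
  classical
  induction hc : G.card using Nat.strong_induction_on generalizing G with
  | _ c ih =>
  induction G using Finset.induction_on with
  | empty => simpa using EventuallyPolynomial.zero
  | insert g G hg _ =>
    rw [Finset.card_insert_of_notMem hg] at hc
    have hIci : EventuallyPolynomial (∑ i, n i) fun m =>
        (((Set.Ici g ∩ gapVectors n m).ncard : ℕ) : ℚ) := by
      obtain ⟨f, hf, N, hN⟩ := EventuallyPolynomial.prod_choose n (fun i => ∑ j, g i j)
      refine ⟨f, hf, max N (Finset.univ.sup fun i => n i + ∑ j, g i j), fun m hm => ?_⟩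
      rw [← hN m fun i => (le_max_left _ _).trans (hm i)]
      beta_reduce
      rw [ncard_gapVectors_Ici n g m fun i =>
        (Finset.le_sup (f := fun i => n i + ∑ j, g i j) (Finset.mem_univ i)).trans
          ((le_max_right _ _).trans (hm i))]
      push_cast
      rfl
    have h1 := ih _ (by lia) G rfl
    have h2 := ih _ (by have := Finset.card_image_le (s := G) (f := fun x => g ⊔ x); lia)
      (G.image fun x => g ⊔ x) rfl
    refine ((hIci.add h1).sub h2).congr fun m => ?_
    have hU : (upperClosure ((insert g G : Finset _) : Set (∀ i, Fin (n i + 1) → ℕ)) : Set _) ∩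
        gapVectors n m = (Set.Ici g ∩ gapVectors n m) ∪
          ((upperClosure (G : Set (∀ i, Fin (n i + 1) → ℕ)) : Set _) ∩ gapVectors n m) := by
      ext a
      simp [or_and_right, exists_or]
    have hI : (upperClosure ((G.image fun x => g ⊔ x : Finset _) : Set (∀ i, Fin (n i + 1) → ℕ)) :
        Set _) ∩ gapVectors n m = (Set.Ici g ∩ gapVectors n m) ∩
          ((upperClosure (G : Set (∀ i, Fin (n i + 1) → ℕ)) : Set _) ∩ gapVectors n m) := by
      ext a
      simp only [Finset.coe_image, Set.mem_inter_iff, SetLike.mem_coe, mem_upperClosure,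
        Set.mem_image, exists_exists_and_eq_and, sup_le_iff, Set.mem_Ici]
      tauto
    have hfin := finite_gapVectors n m
    have h := Set.ncard_union_add_ncard_inter (Set.Ici g ∩ gapVectors n m)
      ((upperClosure (G : Set (∀ i, Fin (n i + 1) → ℕ)) : Set _) ∩ gapVectors n m)
      (hfin.subset Set.inter_subset_right) (hfin.subset Set.inter_subset_right)
    rw [hU, hI, sub_eq_iff_eq_add]
    exact_mod_cast h.symm

/-- The Hilbert function of a monomial ideal: the number of gap vectors of multidegree `m` in an
upper set is eventually a polynomial in `m`. By Dickson's lemma the upper set is generated by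
finitely many vectors. -/
theorem eventuallyPolynomial_isUpperSet {U : Set (∀ i, Fin (n i + 1) → ℕ)} (hU : IsUpperSet U) :
    EventuallyPolynomial (∑ i, n i) fun m => (((U ∩ gapVectors n m).ncard : ℕ) : ℚ) := by
  have hfin : {a | Minimal (· ∈ U) a}.Finite :=
    WellQuasiOrderedLE.finite_of_isAntichain (setOfPred_minimal_antichain _)
  have h := eventuallyPolynomial_upperClosure n hfin.toFinset
  have hcl : (upperClosure ((hfin.toFinset : Finset _) : Set (∀ i, Fin (n i + 1) → ℕ)) : Set _) =
      U := by
    ext a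
    simp only [Set.Finite.coe_toFinset, SetLike.mem_coe, mem_upperClosure, Set.mem_ofPred_eq]
    constructor
    · rintro ⟨b, hb, hba⟩
      exact hU hba hb.prop
    · intro ha
      obtain ⟨b, hba, hb⟩ := exists_minimal_le_of_wellFoundedLT (· ∈ U) a ha
      exact ⟨b, hb, hba⟩
  rwa [hcl] at h

end GapVectors

/-! ### Words and insertion of zeros -/

section Words

/-- The word with nonzero letters `u`, in this order, and gaps `a`: before the letter number `j`
there are `a j` zeros, and the last entry of `a` is the number of zeros at the end. -/
def gapWord : (u : List ℕ) → (Fin (u.length + 1) → ℕ) → List ℕ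
  | [], a => List.replicate (a 0) 0
  | x :: u, a => List.replicate (a 0) 0 ++ x :: gapWord u fun j => a j.succ

/-- `l'` arises from `l` by inserting zeros. -/
inductive ZeroInsertion : List ℕ → List ℕ → Prop
  | nil : ZeroInsertion [] []
  | cons (x : ℕ) {l l' : List ℕ} : ZeroInsertion l l' → ZeroInsertion (x :: l) (x :: l')
  | insert {l l' : List ℕ} : ZeroInsertion l l' → ZeroInsertion l (0 :: l')

theorem length_gapWord (u : List ℕ) (a : Fin (u.length + 1) → ℕ) :
    (gapWord u a).length = u.length + ∑ j, a j := by
  induction u with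
  | nil => simp [gapWord]
  | cons x u ih =>
    have h : ∑ j, a j = a 0 + ∑ j : Fin (u.length + 1), a j.succ := Fin.sum_univ_succ a
    rw [h]
    simp only [gapWord, List.length_append, List.length_replicate, List.length_cons, ih]
    lia

theorem filter_gapWord {u : List ℕ} (hu : ∀ x ∈ u, x ≠ 0) (a : Fin (u.length + 1) → ℕ) :
    (gapWord u a).filter (· ≠ 0) = u := by
  induction u with
  | nil => simp [gapWord]
  | cons x u ih =>
    have hx : x ≠ 0 := hu x (by simp)
    have := ih (fun y hy => hu y (by simp [hy])) fun j => a j.succ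
    simp only [gapWord, List.filter_append, List.filter_replicate]
    rw [List.filter_cons_of_pos (by simpa using hx), this]
    simp

theorem gapWord_injective {u : List ℕ} (hu : ∀ x ∈ u, x ≠ 0) :
    Function.Injective (gapWord u) := by
  induction u with
  | nil =>
    intro a b h
    funext j
    have h' := congrArg List.length h
    obtain rfl : j = 0 := Subsingleton.elim (α := Fin 1) _ _
    simpa [gapWord] using h'
  | cons x u ih =>
    have hx : x ≠ 0 := hu x (by simp)
    intro a b h
    simp only [gapWord] at h
    have h0 : a 0 = b 0 := by
      -- the first gap is the number of zeros in front of the first nonzero letter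
      have h' := congrArg (fun l => (l.takeWhile (· = 0)).length) h
      simpa [List.takeWhile_append, List.takeWhile_replicate, List.takeWhile_cons, hx] using h'
    rw [h0, List.append_cancel_left_eq, List.cons.injEq] at h
    have h1 := ih (fun y hy => hu y (by simp [hy])) h.2
    funext j
    exact Fin.cases h0 (fun j => congrFun h1 j) j

theorem exists_eq_gapWord (l : List ℕ) :
    ∃ a : Fin ((l.filter (· ≠ 0)).length + 1) → ℕ, l = gapWord (l.filter (· ≠ 0)) a := by
  induction l with
  | nil => exact ⟨fun _ => 0, rfl⟩
  | cons x l ih =>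
    obtain ⟨a, ha⟩ := ih
    by_cases hx : x = 0
    · subst hx
      rw [List.filter_cons_of_neg (by simp)]
      generalize l.filter (· ≠ 0) = u at a ha
      refine ⟨Fin.cons (a 0 + 1) fun j => a j.succ, ?_⟩
      rw [ha]
      cases u <;> simp [gapWord, List.replicate_succ]
    · rw [List.filter_cons_of_pos (by simpa using hx)]
      refine ⟨Fin.cons 0 a, ?_⟩
      simp only [gapWord]
      conv_lhs => rw [ha]
      simp

theorem ZeroInsertion.replicate {a b : ℕ} (h : a ≤ b) {l l' : List ℕ} (hl : ZeroInsertion l l') :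
    ZeroInsertion (List.replicate a 0 ++ l) (List.replicate b 0 ++ l') := by
  induction h with
  | refl =>
    induction a with
    | zero => exact hl
    | succ a ih => exact ih.cons 0
  | step _ ih => exact ih.insert

theorem zeroInsertion_gapWord (u : List ℕ) {a b : Fin (u.length + 1) → ℕ} (h : a ≤ b) :
    ZeroInsertion (gapWord u a) (gapWord u b) := by
  induction u with
  | nil => simpa [gapWord] using ZeroInsertion.nil.replicate (h 0)
  | cons x u ih => exact ((ih fun j => h j.succ).cons x).replicate (h 0)

/-- Insertion of zeros is realized by a strictly increasing map of positions. -/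
theorem ZeroInsertion.exists_orderEmbedding {l l' : List ℕ} (h : ZeroInsertion l l') :
    ∃ φ : Fin l.length ↪o Fin l'.length, (∀ p, l'.get (φ p) = l.get p) ∧
      ∀ q, q ∉ Set.range φ → l'.get q = 0 := by
  induction h with
  | nil => exact ⟨RelEmbedding.refl _, fun p => rfl, fun q => q.elim0⟩
  | @cons x l l' _ ih =>
    obtain ⟨φ, h1, h2⟩ := ih
    let ψ : Fin (l.length + 1) → Fin (l'.length + 1) := Fin.cons 0 fun p => (φ p).succ
    have hψ : StrictMono ψ := by
      intro p q
      refine Fin.cases (fun h => ?_) (fun q h => ?_) q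
      · exact absurd h (Fin.not_lt_zero p)
      · revert h
        refine Fin.cases (fun _ => Fin.succ_pos _) (fun p h => ?_) p
        exact Fin.succ_lt_succ_iff.2 (φ.strictMono (Fin.succ_lt_succ_iff.1 h))
    refine ⟨OrderEmbedding.ofStrictMono ψ hψ, ?_, ?_⟩
    · intro p
      refine Fin.cases rfl (fun p => h1 p) p
    · intro q
      refine Fin.cases (fun h => absurd ⟨0, rfl⟩ h) (fun q h => h2 q ?_) q
      rintro ⟨p, rfl⟩
      exact h ⟨p.succ, rfl⟩
  | @insert l l' _ ih =>
    obtain ⟨φ, h1, h2⟩ := ih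
    refine ⟨φ.trans (Fin.succOrderEmb _), fun p => h1 p, fun q => ?_⟩
    refine Fin.cases (fun _ => rfl) (fun q h => h2 q ?_) q
    rintro ⟨p, rfl⟩
    exact h ⟨p, rfl⟩

theorem ZeroInsertion.exists_orderEmbedding_ofFn {n : ℕ} {f : Fin n → ℕ} {l' : List ℕ}
    (h : ZeroInsertion (List.ofFn f) l') :
    ∃ φ : Fin n ↪o Fin l'.length, (∀ p, l'.get (φ p) = f p) ∧
      ∀ q, q ∉ Set.range φ → l'.get q = 0 := by
  obtain ⟨φ, h1, h2⟩ := h.exists_orderEmbedding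
  refine ⟨(Fin.castOrderIso (List.length_ofFn (f := f)).symm).toOrderEmbedding.trans φ,
    fun p => (h1 _).trans (by simp), fun q hq => h2 q ?_⟩
  rintro ⟨p, rfl⟩
  exact hq ⟨Fin.cast List.length_ofFn p, rfl⟩

end Words

/-! ### Coding by words -/

/-- A coding of finite sets `B m`, for `m ∈ ℕ ^ r`, by a natural number (the base) and an `r`-tuple
of words of lengths `m i`, such that the strictly increasing maps of positions act by inserting
zeros, the letters and bases are bounded, and the number of nonzero letters is at most `d`. -/
structure WordModel (r d : ℕ) (B : (Fin r → ℕ) → Type) where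
  base : ∀ {m : Fin r → ℕ}, B m → ℕ
  word : ∀ {m : Fin r → ℕ}, B m → ∀ i, Fin (m i) → ℕ
  ext : ∀ {m : Fin r → ℕ} {g h : B m}, base g = base h → word g = word h → g = h
  push : ∀ {m m' : Fin r → ℕ}, (∀ i, Fin (m i) ↪o Fin (m' i)) → B m → B m'
  base_push : ∀ {m m' : Fin r → ℕ} (φ : ∀ i, Fin (m i) ↪o Fin (m' i)) (g : B m),
    base (push φ g) = base g
  word_push : ∀ {m m' : Fin r → ℕ} (φ : ∀ i, Fin (m i) ↪o Fin (m' i)) (g : B m) (i : Fin r)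
    (p : Fin (m i)), word (push φ g) i (φ i p) = word g i p
  word_push_of_notMem : ∀ {m m' : Fin r → ℕ} (φ : ∀ i, Fin (m i) ↪o Fin (m' i)) (g : B m)
    (i : Fin r) (q : Fin (m' i)), q ∉ Set.range (φ i) → word (push φ g) i q = 0
  exists_bound : ∃ N, ∀ (m : Fin r → ℕ) (g : B m), base g < N ∧ ∀ i p, word g i p < N
  sum_card_le : ∀ {m : Fin r → ℕ} (g : B m),
    ∑ i, (Finset.univ.filter fun p => word g i p ≠ 0).card ≤ d

theorem length_filter_ofFn {n : ℕ} (f : Fin n → ℕ) :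
    ((List.ofFn f).filter (· ≠ 0)).length = (Finset.univ.filter fun p => f p ≠ 0).card := by
  rw [List.ofFn_eq_map, List.filter_map, List.length_map]
  rfl

namespace WordModel

variable {r d : ℕ} {B : (Fin r → ℕ) → Type} (W : WordModel r d B) {m m' : Fin r → ℕ}

include W in
theorem finite (m : Fin r → ℕ) : Finite (B m) := by
  obtain ⟨N, hN⟩ := W.exists_bound
  refine Finite.of_injective (β := Fin N × (∀ i, Fin (m i) → Fin N))
    (fun g => (⟨W.base g, (hN m g).1⟩, fun i p => ⟨W.word g i p, (hN m g).2 i p⟩)) ?_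
  intro g h hgh
  rw [Prod.mk.injEq] at hgh
  refine W.ext (congrArg Fin.val hgh.1) (funext fun i => funext fun p => ?_)
  exact congrArg Fin.val (congrFun (congrFun hgh.2 i) p)

/-- The coding of the elements of `B m`, with values in a lexicographically ordered set. -/
def key (g : B m) : ℕ ×ₗ Lex ((Σₗ i, Fin (m i)) → ℕ) :=
  toLex (W.base g, toLex fun p => W.word g (ofLex p).1 (ofLex p).2)

theorem key_injective : Function.Injective (W.key (m := m)) := by
  intro g h hgh
  have h' := Prod.mk.inj (toLex.injective hgh)
  refine W.ext h'.1 (funext fun i => funext fun p => ?_)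
  exact congrFun (toLex.injective h'.2) (toLex ⟨i, p⟩)

/-- Insertion of zeros at prescribed positions is strictly increasing for the lexicographic
order. -/
theorem key_push_lt (φ : ∀ i, Fin (m i) ↪o Fin (m' i)) {g h : B m} (hgh : W.key g < W.key h) :
    W.key (W.push φ g) < W.key (W.push φ h) := by
  rw [key, key, Prod.Lex.toLex_lt_toLex] at hgh ⊢
  simp only [W.base_push]
  refine hgh.imp_right fun ⟨h1, h2⟩ => ⟨h1, ?_⟩
  -- if the words first differ at `(i, p)`, then the images first differ at `(i, φ i p)`
  obtain ⟨⟨i, p⟩, hlt, hp⟩ := h2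
  refine ⟨toLex ⟨i, φ i p⟩, ?_, ?_⟩
  · rintro ⟨j, q⟩ hq
    by_cases hr : q ∈ Set.range (φ j)
    · obtain ⟨q, rfl⟩ := hr
      have hlt' := hlt (toLex ⟨j, q⟩) ?_
      · refine (W.word_push φ g j q).trans (Eq.trans hlt' (W.word_push φ h j q).symm)
      · rcases Sigma.Lex.lt_def.1 hq with hji | ⟨hji, hqp⟩
        · exact Sigma.Lex.lt_def.2 (Or.inl hji)
        · obtain rfl : j = i := hji
          exact Sigma.Lex.lt_def.2 (Or.inr ⟨rfl, (φ j).lt_iff_lt.1 hqp⟩)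
    · exact (W.word_push_of_notMem φ g j q hr).trans (W.word_push_of_notMem φ h j q hr).symm
  · exact (W.word_push φ g i p).trans_lt (lt_of_lt_of_eq hp (W.word_push φ h i p).symm)

/-- The type of an element: its base and its nonzero letters, without their positions. -/
def type (g : B m) : ℕ × (Fin r → List ℕ) :=
  (W.base g, fun i => (List.ofFn (W.word g i)).filter (· ≠ 0))

theorem finite_types : {t | ∃ m, ∃ g : B m, W.type g = t}.Finite := by
  obtain ⟨N, hN⟩ := W.exists_bound
  have hL : ((List.map fun x : Fin N => (x : ℕ)) '' {l : List (Fin N) | l.length ≤ d}).Finite :=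
    (List.finite_length_le (Fin N) d).image _
  refine ((Set.finite_Iio N).prod (Set.Finite.pi' fun _ : Fin r => hL)).subset ?_
  rintro _ ⟨m, g, rfl⟩
  refine ⟨(hN m g).1, fun i => ?_⟩
  have hlt : ∀ x ∈ (W.type g).2 i, x < N := by
    intro x hx
    obtain ⟨p, rfl⟩ := (List.mem_ofFn' _ _).1 (List.mem_of_mem_filter hx)
    exact (hN m g).2 i p
  refine ⟨((W.type g).2 i).pmap Fin.mk hlt, ?_, ?_⟩
  · rw [Set.mem_ofPred_eq, List.length_pmap]
    refine (length_filter_ofFn _).trans_le ((Finset.single_le_sum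
      (f := fun i => (Finset.univ.filter fun p => W.word g i p ≠ 0).card)
      (fun _ _ => Nat.zero_le _) (Finset.mem_univ i)).trans (W.sum_card_le g))
  · simp [List.map_pmap]

/-- The elements of a given type in a family of subsets that is closed under insertion of zeros
correspond to an upper set of gap vectors. -/
theorem eventuallyPolynomial_type (I : ∀ m, Set (B m))
    (hI : ∀ {m m' : Fin r → ℕ} (φ : ∀ i, Fin (m i) ↪o Fin (m' i)), ∀ g ∈ I m, W.push φ g ∈ I m')
    {t : ℕ × (Fin r → List ℕ)} (ht : ∃ m, ∃ g : B m, W.type g = t) :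
    EventuallyPolynomial d fun m => (({g ∈ I m | W.type g = t}.ncard : ℕ) : ℚ) := by
  have hpos : ∀ i, ∀ x ∈ t.2 i, x ≠ 0 := by
    obtain ⟨m, g, rfl⟩ := ht
    intro i x hx
    simpa using List.of_mem_filter hx
  have hd : ∑ i, (t.2 i).length ≤ d := by
    obtain ⟨m, g, rfl⟩ := ht
    refine (Finset.sum_congr rfl fun i _ => ?_).trans_le (W.sum_card_le g)
    exact length_filter_ofFn _
  let U : Set (∀ i, Fin ((t.2 i).length + 1) → ℕ) := {a | ∃ m, ∃ g ∈ I m, W.base g = t.1 ∧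
    ∀ i, List.ofFn (W.word g i) = gapWord (t.2 i) (a i)}
  have hU : IsUpperSet U := by
    rintro a b hab ⟨m, g, hg, hbase, hw⟩
    choose φ h1 h2 using fun i =>
      (hw i ▸ zeroInsertion_gapWord (t.2 i) (hab i)).exists_orderEmbedding_ofFn
    refine ⟨_, W.push φ g, hI φ g hg, (W.base_push φ g).trans hbase, fun i => ?_⟩
    have : W.word (W.push φ g) i = (gapWord (t.2 i) (b i)).get := by
      funext q
      by_cases hq : q ∈ Set.range (φ i)
      · obtain ⟨p, rfl⟩ := hq
        rw [W.word_push, h1]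
      · rw [W.word_push_of_notMem φ g i q hq, h2 i q hq]
    rw [this, List.ofFn_get]
  refine ((eventuallyPolynomial_isUpperSet _ hU).mono hd).congr fun m => ?_
  congr 1
  symm
  have hgap : ∀ g ∈ {g ∈ I m | W.type g = t}, ∀ i, ∃ a, List.ofFn (W.word g i) =
      gapWord (t.2 i) a := by
    rintro g ⟨-, rfl⟩ i
    exact exists_eq_gapWord _
  choose a ha using hgap
  refine Set.ncard_congr a (fun g hg => ⟨⟨m, g, hg.1, congrArg Prod.fst hg.2, ha g hg⟩,
    fun i => ?_⟩) (fun g h hg hh hgh => ?_) ?_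
  · rw [← length_gapWord, ← ha g hg, List.length_ofFn]
  · refine W.ext ((congrArg Prod.fst hg.2).trans (congrArg Prod.fst hh.2).symm)
      (funext fun i => List.ofFn_injective ?_)
    rw [ha g hg, ha h hh, hgh]
  · rintro b ⟨⟨m', g, hg, hbase, hw⟩, hb⟩
    obtain rfl : m' = m := funext fun i => by
      rw [← hb i, ← length_gapWord, ← hw i, List.length_ofFn]
    have hgt : g ∈ {g ∈ I m' | W.type g = t} := by
      refine ⟨hg, Prod.ext hbase (funext fun i => ?_)⟩
      change (List.ofFn (W.word g i)).filter (· ≠ 0) = _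
      rw [hw i, filter_gapWord (hpos i)]
    refine ⟨g, hgt, funext fun i => gapWord_injective (hpos i) ?_⟩
    rw [← ha g hgt, hw i]

theorem eventuallyPolynomial_ncard (I : ∀ m, Set (B m))
    (hI : ∀ {m m' : Fin r → ℕ} (φ : ∀ i, Fin (m i) ↪o Fin (m' i)), ∀ g ∈ I m, W.push φ g ∈ I m') :
    EventuallyPolynomial d fun m => (((I m).ncard : ℕ) : ℚ) := by
  classical
  refine (EventuallyPolynomial.sum W.finite_types.toFinset fun t ht =>
    W.eventuallyPolynomial_type I hI (W.finite_types.mem_toFinset.1 ht)).congr fun m => ?_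
  have := W.finite m
  have := Fintype.ofFinite (B m)
  rw [← Nat.cast_sum, Set.ncard_eq_toFinset_card' (I m),
    Finset.card_eq_sum_card_fiberwise (f := W.type) (t := W.finite_types.toFinset)
      fun g _ => W.finite_types.mem_toFinset.2 ⟨m, g, rfl⟩]
  congr 1
  refine Finset.sum_congr rfl fun t _ => ?_
  rw [← Set.ncard_coe_finset]
  congr 1
  ext g
  simp

/-- The dimension of a family of subspaces of the spaces with bases `B m` that is closed under
insertion of zeros is eventually a polynomial: it is the number of leading basis vectors, and these
are closed under insertion of zeros. -/
theorem eventuallyPolynomial_finrank {k : Type u} [Field k] (S : ∀ m, Submodule k (B m →₀ k))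
    (hS : ∀ {m m' : Fin r → ℕ} (φ : ∀ i, Fin (m i) ↪o Fin (m' i)), ∀ w ∈ S m,
      Finsupp.mapDomain (W.push φ) w ∈ S m') :
    EventuallyPolynomial d fun m => ((Module.finrank k (S m) : ℕ) : ℚ) := by
  let _ : ∀ m, LinearOrder (B m) := fun m => LinearOrder.lift' W.key W.key_injective
  refine (W.eventuallyPolynomial_ncard (fun m => leadingSet (S m)) fun φ g hg =>
    map_mem_leadingSet (φ := W.push φ) (fun _ _ h => W.key_push_lt φ h) (hS φ) hg).congr fun m => ?_
  have := W.finite m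
  rw [finrank_eq_ncard_leadingSet]

/-- A larger bound on the number of nonzero letters. -/
def mono {d' : ℕ} (h : d ≤ d') : WordModel r d' B where
  __ := W
  sum_card_le g := (W.sum_card_le g).trans h

/-- A finite disjoint union of codings; the index becomes part of the base. -/
def sigma {n : ℕ} {B : Fin n → (Fin r → ℕ) → Type} (W : ∀ j, WordModel r d (B j)) :
    WordModel r d fun m => Σ j, B j m where
  base s := Nat.pair s.1 ((W s.1).base s.2)
  word s := (W s.1).word s.2
  ext {m} := by
    rintro ⟨i, g⟩ ⟨j, h⟩ h1 h2
    obtain ⟨h3, h4⟩ := Nat.pair_eq_pair.1 h1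
    obtain rfl := Fin.ext h3
    exact congrArg (Sigma.mk i) ((W i).ext h4 h2)
  push φ s := ⟨s.1, (W s.1).push φ s.2⟩
  base_push φ s := by rw [(W s.1).base_push]
  word_push φ s := (W s.1).word_push φ s.2
  word_push_of_notMem φ s := (W s.1).word_push_of_notMem φ s.2
  exists_bound := by
    choose N hN using fun j => (W j).exists_bound
    refine ⟨(max n (Finset.univ.sup N) + 1) ^ 2, fun m s => ⟨?_, fun i p => ?_⟩⟩
    · have h1 := ((hN s.1) m s.2).1
      have h2 : N s.1 ≤ Finset.univ.sup N := Finset.le_sup (Finset.mem_univ s.1)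
      refine (Nat.pair_lt_max_add_one_sq _ _).trans_le (Nat.pow_le_pow_left ?_ 2)
      have h3 := s.1.2
      refine Nat.add_le_add_right (max_le_max h3.le (h1.le.trans h2)) 1
    · have h1 := ((hN s.1) m s.2).2 i p
      have h2 : N s.1 ≤ Finset.univ.sup N := Finset.le_sup (Finset.mem_univ s.1)
      have h3 : Finset.univ.sup N ≤ max n (Finset.univ.sup N) := le_max_right _ _
      nlinarith
  sum_card_le s := (W s.1).sum_card_le s.2

end WordModel

/-! ### Small and smallish modules -/

namespace CatModule

section Free

variable {C : Type v} [Category.{0} C] (k : Type u) [Field k] {n : ℕ} (x : Fin n → C)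

/-- Composition with `f` on the disjoint union of the sets `Hom(x j, y)`. -/
def sigmaPush {y z : C} (f : y ⟶ z) (s : Σ j, x j ⟶ y) : Σ j, x j ⟶ z := ⟨s.1, s.2 ≫ f⟩

/-- A concrete model of the direct sum of the principal projectives `P_{x j}`: its value at `y` has
as basis the disjoint union of the sets `Hom(x j, y)`. -/
noncomputable def sigmaPrincipal : C ⥤ ModuleCat.{u} k where
  obj y := ModuleCat.of k ((Σ j, x j ⟶ y) →₀ k)
  map f := ModuleCat.ofHom (Finsupp.lmapDomain k k (sigmaPush x f))
  map_id y := by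
    have h : sigmaPush x (𝟙 y) = id := funext fun s => by simp [sigmaPush]
    rw [h, Finsupp.lmapDomain_id]
    rfl
  map_comp f g := by
    have h : sigmaPush x (f ≫ g) = sigmaPush x g ∘ sigmaPush x f :=
      funext fun s => by simp [sigmaPush]
    rw [h, Finsupp.lmapDomain_comp]
    rfl

/-- The inclusion of a summand. -/
noncomputable def sigmaPrincipalι (j : Fin n) : principal k (x j) ⟶ sigmaPrincipal k x where
  app y := ModuleCat.ofHom (Finsupp.lmapDomain k k fun g => (⟨j, g⟩ : Σ j, x j ⟶ y))
  naturality y z f := by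
    refine ModuleCat.hom_ext (Finsupp.lhom_ext' fun g => LinearMap.ext_ring ?_)
    change Finsupp.mapDomain _ (Finsupp.mapDomain (fun g => g ≫ f) (Finsupp.single g 1)) =
      Finsupp.mapDomain (sigmaPush x f) (Finsupp.mapDomain _ (Finsupp.single g 1))
    simp only [Finsupp.mapDomain_single]
    rfl

/-- The comparison map from the concrete to the abstract direct sum. -/
noncomputable def sigmaPrincipalToCoproduct :
    sigmaPrincipal k x ⟶ ∐ fun i => principal k (x i) where
  app y := ModuleCat.ofHom (Finsupp.linearCombination k fun s : Σ j, x j ⟶ y =>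
    ((Sigma.ι (fun i => principal k (x i)) s.1).app y).hom (Finsupp.single s.2 1))
  naturality y z f := by
    refine ModuleCat.hom_ext (Finsupp.lhom_ext' fun s => LinearMap.ext_ring ?_)
    have h := ConcreteCategory.congr_hom
      ((Sigma.ι (fun i => principal k (x i)) s.1).naturality f) (Finsupp.single s.2 1)
    refine Eq.trans ?_ (h.trans ?_)
    · change Finsupp.linearCombination k _ (Finsupp.mapDomain (sigmaPush x f) (Finsupp.single s 1)) =
        ((Sigma.ι (fun i => principal k (x i)) s.1).app z).hom
          (Finsupp.mapDomain (fun g => g ≫ f) (Finsupp.single s.2 1))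
      rw [Finsupp.mapDomain_single, Finsupp.mapDomain_single, Finsupp.linearCombination_single,
        one_smul]
      rfl
    · refine congrArg ((∐ fun i => principal k (x i)).map f).hom (Eq.symm ?_)
      exact (Finsupp.linearCombination_single k 1 s).trans (one_smul k _)

theorem sigmaPrincipalι_comp (j : Fin n) :
    sigmaPrincipalι k x j ≫ sigmaPrincipalToCoproduct k x =
      Sigma.ι (fun i => principal k (x i)) j := by
  refine NatTrans.ext (funext fun y =>
    ModuleCat.hom_ext (Finsupp.lhom_ext' fun s => LinearMap.ext_ring ?_))
  change Finsupp.linearCombination k _ (Finsupp.mapDomain _ (Finsupp.single s 1)) = _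
  rw [Finsupp.mapDomain_single]
  exact (Finsupp.linearCombination_single k 1 _).trans (one_smul k _)

instance : Epi (sigmaPrincipalToCoproduct k x) where
  left_cancellation a b h := by
    refine Sigma.hom_ext _ _ fun j => ?_
    rw [← sigmaPrincipalι_comp, Category.assoc, Category.assoc, h]

end Free

theorem surjective_of_epi {C : Type v} [Category.{0} C] {k : Type u} [Field k]
    {M N : C ⥤ ModuleCat.{u} k} (f : M ⟶ N) [Epi f] (y : C) :
    Function.Surjective (f.app y).hom :=
  (ModuleCat.epi_iff_surjective _).1 inferInstance

theorem injective_of_mono {C : Type v} [Category.{0} C] {k : Type u} [Field k]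
    {M N : C ⥤ ModuleCat.{u} k} (f : M ⟶ N) [Mono f] (y : C) :
    Function.Injective (f.app y).hom :=
  (ModuleCat.mono_iff_injective _).1 inferInstance

/-- A small module is, at each object, a quotient of two submodules `K ⊆ S` of a finite direct sum
of principal projectives; so its dimension is a difference of dimensions of such submodules. -/
theorem IsSmall.exists_submodules {C : Type v} [Category.{0} C] {k : Type u} [Field k]
    {deg : C → ℕ} {d : ℕ} {M : C ⥤ ModuleCat.{u} k} (hM : IsSmall deg d M) :
    ∃ (n : ℕ) (x : Fin n → C), (∀ i, deg (x i) ≤ d) ∧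
      ∃ S K : ∀ y, Submodule k ((Σ j, x j ⟶ y) →₀ k),
        (∀ {y z : C} (f : y ⟶ z), ∀ w ∈ S y, Finsupp.mapDomain (sigmaPush x f) w ∈ S z) ∧
        (∀ {y z : C} (f : y ⟶ z), ∀ w ∈ K y, Finsupp.mapDomain (sigmaPush x f) w ∈ K z) ∧
        ∀ y, Finite (Σ j, x j ⟶ y) → Module.Finite k (M.obj y) ∧
          Module.finrank k (S y) = Module.finrank k (M.obj y) + Module.finrank k (K y) := by
  obtain ⟨N, L, ⟨n, x, hx, π₀, hπ₀⟩, ι, π, hι, hπ⟩ := hM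
  let Φ : sigmaPrincipal k x ⟶ N := sigmaPrincipalToCoproduct k x ≫ π₀
  have hΦ : Epi Φ := epi_comp _ _
  refine ⟨n, x, hx, fun y => (LinearMap.range (ι.app y).hom).comap (Φ.app y).hom,
    fun y => ((LinearMap.ker (π.app y).hom).map (ι.app y).hom).comap (Φ.app y).hom, ?_, ?_, ?_⟩
  · rintro y z f w ⟨l, hl⟩
    refine ⟨(L.map f).hom l, ?_⟩
    have h1 := ConcreteCategory.congr_hom (ι.naturality f) l
    have h2 := ConcreteCategory.congr_hom (Φ.naturality f) w
    exact h1.trans ((congrArg (N.map f).hom hl).trans h2.symm)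
  · rintro y z f w ⟨l, hl0, hl⟩
    refine ⟨(L.map f).hom l, ?_, ?_⟩
    · have h := ConcreteCategory.congr_hom (π.naturality f) l
      exact h.trans ((congrArg (M.map f).hom hl0).trans (map_zero _))
    · have h1 := ConcreteCategory.congr_hom (ι.naturality f) l
      have h2 := ConcreteCategory.congr_hom (Φ.naturality f) w
      exact h1.trans ((congrArg (N.map f).hom hl).trans h2.symm)
  · intro y hfin
    have hQ : Module.Finite k ((sigmaPrincipal k x).obj y) :=
      inferInstanceAs (Module.Finite k ((Σ j, x j ⟶ y) →₀ k))
    have hN : Module.Finite k (N.obj y) := Module.Finite.of_surjective _ (surjective_of_epi Φ y)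
    have hL : Module.Finite k (L.obj y) := Module.Finite.of_injective _ (injective_of_mono ι y)
    refine ⟨Module.Finite.of_surjective _ (surjective_of_epi π y), ?_⟩
    have e1 := finrank_comap_of_surjective (surjective_of_epi Φ y) (LinearMap.range (ι.app y).hom)
    have e2 := finrank_comap_of_surjective (surjective_of_epi Φ y)
      ((LinearMap.ker (π.app y).hom).map (ι.app y).hom)
    have e3 := LinearMap.finrank_range_of_inj (injective_of_mono ι y)
    have e4 := (Submodule.equivMapOfInjective _ (injective_of_mono ι y)
      (LinearMap.ker (π.app y).hom)).finrank_eq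
    have e5 := LinearMap.finrank_range_add_finrank_ker (π.app y).hom
    rw [LinearMap.range_eq_top.2 (surjective_of_epi π y), finrank_top] at e5
    refine e1.trans ?_
    refine Eq.trans ?_ (congrArg _ e2.symm)
    rw [e3, ← e4, ← e5]
    ring

/-- If the sets `Hom(x, Y m)` with `deg x ≤ d` are coded by words with at most `d` nonzero letters,
compatibly with maps `Y m ⟶ Y m'` that act by inserting zeros, then the dimension of a `d`-smallish
module at `Y m` is eventually a polynomial of degree at most `d`. -/
theorem IsSmallish.eventuallyPolynomial {C : Type v} [Category.{0} C] {k : Type u} [Field k]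
    {deg : C → ℕ} {d r : ℕ} {M : C ⥤ ModuleCat.{u} k} (hM : IsSmallish deg d M)
    (Y : (Fin r → ℕ) → C)
    (c : ∀ {m m' : Fin r → ℕ}, (∀ i, Fin (m i) ↪o Fin (m' i)) → (Y m ⟶ Y m'))
    (W : ∀ x : C, WordModel r (deg x) fun m => x ⟶ Y m)
    (hW : ∀ (x : C) {m m' : Fin r → ℕ} (φ : ∀ i, Fin (m i) ↪o Fin (m' i)) (g : x ⟶ Y m),
      (W x).push φ g = g ≫ c φ) :
    (∀ m, Module.Finite k (M.obj (Y m))) ∧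
      EventuallyPolynomial d fun m => ((Module.finrank k (M.obj (Y m)) : ℕ) : ℚ) := by
  obtain ⟨Φ, hΦ⟩ := hM
  obtain ⟨n, x, hx, S, K, hS, hK, hdim⟩ := hΦ.exists_submodules
  let V : WordModel r d fun m => Σ j, x j ⟶ Y m := WordModel.sigma (fun j => (W (x j)).mono (hx j))
  have hV : ∀ {m m' : Fin r → ℕ} (φ : ∀ i, Fin (m i) ↪o Fin (m' i)),
      V.push φ = sigmaPush x (c φ) := fun φ => funext fun s => by
    exact congrArg (Sigma.mk s.1) (hW _ φ s.2)
  have hfin : ∀ m, Module.Finite k (M.obj (Y m)) ∧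
      Module.finrank k (M.obj (Y m)) = Module.finrank k (Φ.gr.obj (Y m)) := fun m => by
    have := (hdim (Y m) (V.finite m)).1
    exact @finrank_eq_finrank_graded k _ _ _ _ (fun i => Φ.F i (Y m)) (Φ.mono _) (Φ.exhaustive _)
      (Φ.separated _) this
  refine ⟨fun m => (hfin m).1, ?_⟩
  have h1 := V.eventuallyPolynomial_finrank (fun m => S (Y m)) fun φ w hw => by
    rw [hV]
    exact hS _ w hw
  have h2 := V.eventuallyPolynomial_finrank (fun m => K (Y m)) fun φ w hw => by
    rw [hV]
    exact hK _ w hw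
  refine (h1.sub h2).congr fun m => ?_
  rw [(hfin m).2, (hdim (Y m) (V.finite m)).2]
  push_cast
  ring

end CatModule

/-! ### Contractions of sprouted trees -/

namespace FinTree

section Sprout

variable (T : FinTree) {r : ℕ} (v : Fin r → T.V) {m m' : Fin r → ℕ}

open Classical in
/-- The map on vertices that keeps the leaves at the positions in the image of `φ` and contracts
all other new leaves into the vertices to which they are attached. -/
noncomputable def sproutMap (φ : ∀ i, Fin (m i) ↪o Fin (m' i)) :
    T.V ⊕ (Σ i : Fin r, Fin (m' i)) → T.V ⊕ (Σ i : Fin r, Fin (m i))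
  | .inl a => .inl a
  | .inr ⟨i, q⟩ => if h : ∃ p, φ i p = q then .inr ⟨i, h.choose⟩ else .inl (v i)

variable {T}

theorem sproutMap_inr (φ : ∀ i, Fin (m i) ↪o Fin (m' i)) (i : Fin r) (p : Fin (m i)) :
    T.sproutMap v φ (.inr ⟨i, φ i p⟩) = .inr ⟨i, p⟩ := by
  have h : ∃ p', φ i p' = φ i p := ⟨p, rfl⟩
  rw [sproutMap, dif_pos h, (φ i).injective h.choose_spec]

theorem sproutMap_inr_of_notMem (φ : ∀ i, Fin (m i) ↪o Fin (m' i)) (i : Fin r) (q : Fin (m' i))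
    (h : q ∉ Set.range (φ i)) : T.sproutMap v φ (.inr ⟨i, q⟩) = .inl (v i) :=
  dif_neg h

variable (T)

/-- The contraction of sprouted trees that belongs to an `r`-tuple of strictly increasing maps. -/
noncomputable def sproutContraction (φ : ∀ i, Fin (m i) ↪o Fin (m' i)) :
    Contraction (T.sprout v m') (T.sprout v m) where
  toFun := T.sproutMap v φ
  map_adj := by
    have key : ∀ (i : Fin r) (q : Fin (m' i)),
        T.sproutMap v φ (.inr ⟨i, q⟩) = .inl (v i) ∨
          (T.sproutGraph v m).Adj (.inl (v i)) (T.sproutMap v φ (.inr ⟨i, q⟩)) := by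
      intro i q
      by_cases h : q ∈ Set.range (φ i)
      · obtain ⟨p, rfl⟩ := h
        rw [sproutMap_inr]
        exact Or.inr rfl
      · exact Or.inl (sproutMap_inr_of_notMem v φ i q h)
    rintro (a | ⟨i, p⟩) (b | ⟨j, q⟩) h
    · exact Or.inr h
    · obtain rfl : a = v j := h
      exact (key j q).imp_left Eq.symm
    · obtain rfl : b = v i := h
      exact (key i p).imp_right SimpleGraph.Adj.symm
    · exact h.elim
  fiber_connected := by
    rintro (a | ⟨i, p⟩)
    · -- the fiber is a star with center `a`
      have ha : (Sum.inl a : T.V ⊕ (Σ i : Fin r, Fin (m' i))) ∈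
        T.sproutMap v φ ⁻¹' {Sum.inl a} := rfl
      have key : ∀ x : T.sproutMap v φ ⁻¹' {Sum.inl a},
          ((T.sproutGraph v m').induce (T.sproutMap v φ ⁻¹' {Sum.inl a})).Reachable x
            ⟨_, ha⟩ := by
        rintro ⟨b | ⟨i, q⟩, hx⟩
        · obtain rfl : b = a := Sum.inl_injective hx
          exact SimpleGraph.Reachable.refl _
        · by_cases h : q ∈ Set.range (φ i)
          · obtain ⟨p, rfl⟩ := h
            rw [Set.mem_preimage, sproutMap_inr] at hx
            exact absurd hx (by simp)
          · refine SimpleGraph.Adj.reachable (SimpleGraph.induce_adj.2 ?_)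
            rw [Set.mem_preimage, sproutMap_inr_of_notMem v φ i q h] at hx
            exact (Sum.inl_injective hx).symm
      exact (SimpleGraph.connected_iff _).2 ⟨fun x y => (key x).trans (key y).symm, ⟨⟨_, ha⟩⟩⟩
    · -- the fiber is a point
      have key : ∀ x : T.sproutMap v φ ⁻¹' {Sum.inr ⟨i, p⟩}, x.1 = .inr ⟨i, φ i p⟩ := by
        rintro ⟨b | ⟨j, q⟩, hx⟩
        · exact absurd hx (by simp [sproutMap])
        · by_cases h : q ∈ Set.range (φ j)
          · obtain ⟨p', rfl⟩ := h
            rw [Set.mem_preimage, sproutMap_inr] at hx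
            obtain ⟨rfl, hp⟩ := Sigma.mk.inj (Sum.inr_injective hx)
            exact congrArg (fun p => (Sum.inr ⟨j, φ j p⟩ : T.V ⊕ (Σ i : Fin r, Fin (m' i))))
              (eq_of_heq hp)
          · rw [Set.mem_preimage, sproutMap_inr_of_notMem v φ j q h] at hx
            exact absurd hx (by simp)
      refine (SimpleGraph.connected_iff _).2 ⟨fun x y => ?_, ⟨⟨_, sproutMap_inr v φ i p⟩⟩⟩
      rw [Subtype.ext ((key x).trans (key y).symm)]

variable {T v}

/-- A new leaf that is not contracted into the vertex to which it is attached is alone in its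
fiber. -/
theorem Contraction.eq_of_ne {R : FinTree} (h : Contraction (T.sprout v m) R) {i : Fin r}
    {p : Fin (m i)} (hne : h.toFun (.inr ⟨i, p⟩) ≠ h.toFun (.inl (v i)))
    {y : (T.sprout v m).V} (hy : h.toFun y = h.toFun (.inr ⟨i, p⟩)) : y = .inr ⟨i, p⟩ := by
  obtain ⟨w⟩ := (h.fiber_connected (h.toFun (.inr ⟨i, p⟩))).preconnected ⟨.inr ⟨i, p⟩, rfl⟩ ⟨y, hy⟩
  cases w with
  | nil => rfl
  | @cons _ z _ hadj _ =>
    obtain ⟨z | z, hz⟩ := z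
    · have hzv : z = v i := SimpleGraph.induce_adj.1 hadj
      subst hzv
      exact absurd hz.symm hne
    · exact (SimpleGraph.induce_adj.1 hadj : False).elim

/-- A contraction from a sprouted tree to `R` contracts all but at most `|R|` of the new leaves. -/
theorem Contraction.sum_card_le {R : FinTree} [DecidableEq R.V]
    (h : Contraction (T.sprout v m) R) :
    ∑ i, (Finset.univ.filter fun p => h.toFun (.inr ⟨i, p⟩) ≠ h.toFun (.inl (v i))).card ≤
      R.numEdges := by
  classical
  have := R.finite
  have := Fintype.ofFinite R.V
  obtain ⟨t⟩ := T.isTree.connected.nonempty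
  rw [← Finset.card_sigma]
  have hcard : R.numEdges + 1 = Fintype.card R.V := by
    rw [numEdges, Nat.card_eq_fintype_card, ← SimpleGraph.edgeFinset_card]
    exact R.isTree.card_edgeFinset
  have hlt : (Finset.univ.erase (h.toFun (.inl t))).card + 1 = Fintype.card R.V :=
    Finset.card_erase_add_one (Finset.mem_univ _)
  rw [show R.numEdges = (Finset.univ.erase (h.toFun (.inl t))).card by lia]
  -- the images of these leaves are distinct, and different from the image of any vertex of `T`
  refine Finset.card_le_card_of_injOn (fun s => h.toFun (.inr s)) ?_ ?_
  · rintro ⟨i, p⟩ hs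
    simp only [Finset.coe_sigma, Finset.mem_coe, Set.mem_sigma_iff, Finset.mem_filter,
      Finset.mem_univ, true_and] at hs
    refine Finset.mem_coe.2 (Finset.mem_erase.2 ⟨fun he => ?_, Finset.mem_univ _⟩)
    exact Sum.inl_ne_inr (h.eq_of_ne hs he.symm)
  · rintro ⟨i, p⟩ hs ⟨j, q⟩ - he
    simp only [Finset.coe_sigma, Finset.mem_coe, Set.mem_sigma_iff, Finset.mem_filter,
      Finset.mem_univ, true_and] at hs
    exact (Sum.inr_injective (h.eq_of_ne hs he.symm)).symm

variable (T v)

open Classical in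
/-- The coding of the contractions from the sprouted trees to `R` that belong to a family of sets
`B m` which is closed under the contractions of sprouted trees. The base is the restriction to `T`;
a letter is `0` if the leaf is contracted into the vertex to which it is attached, and codes the
image of the leaf otherwise. -/
noncomputable def wordModel (R : FinTree) (B : (Fin r → ℕ) → Type)
    (toC : ∀ {m}, B m → Contraction (T.sprout v m) R)
    (toC_inj : ∀ {m}, Function.Injective (toC (m := m)))
    (push : ∀ {m m' : Fin r → ℕ}, (∀ i, Fin (m i) ↪o Fin (m' i)) → B m → B m')
    (toC_push : ∀ {m m' : Fin r → ℕ} (φ : ∀ i, Fin (m i) ↪o Fin (m' i)) (g : B m),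
      toC (push φ g) = (T.sproutContraction v φ).comp (toC g)) :
    WordModel r R.numEdges B :=
  have := R.finite
  have := T.finite
  let e : R.V ≃ Fin (Nat.card R.V) := Finite.equivFin R.V
  let e' : (T.V → R.V) ≃ Fin (Nat.card (T.V → R.V)) := Finite.equivFin (T.V → R.V)
  { base := fun g => e' fun a => (toC g).toFun (.inl a)
    word := fun g i p => if (toC g).toFun (.inr ⟨i, p⟩) = (toC g).toFun (.inl (v i)) then 0
      else e ((toC g).toFun (.inr ⟨i, p⟩)) + 1
    ext := by
      intro m g h hb hw
      have hb' := e'.injective (Fin.ext hb)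
      refine toC_inj (Contraction.ext (funext ?_))
      rintro (a | ⟨i, p⟩)
      · exact congrFun hb' a
      · have hp := congrFun (congrFun hw i) p
        have hv : (toC g).toFun (.inl (v i)) = (toC h).toFun (.inl (v i)) := congrFun hb' (v i)
        split_ifs at hp with h1 h2 h2
        · rw [h1, h2, hv]
        · exact e.injective (Fin.ext (Nat.succ_injective hp))
    push := push
    base_push := fun φ g => by
      rw [toC_push]
      rfl
    word_push := fun φ g i p => by
      have h1 : (toC (push φ g)).toFun (.inr ⟨i, φ i p⟩) = (toC g).toFun (.inr ⟨i, p⟩) := by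
        rw [toC_push]
        exact congrArg (toC g).toFun (sproutMap_inr v φ i p)
      have h2 : (toC (push φ g)).toFun (.inl (v i)) = (toC g).toFun (.inl (v i)) := by
        rw [toC_push]
        rfl
      rw [h1, h2]
    word_push_of_notMem := fun φ g i q hq => by
      refine if_pos ?_
      rw [toC_push]
      exact congrArg (toC g).toFun (sproutMap_inr_of_notMem v φ i q hq)
    exists_bound := by
      refine ⟨max (Nat.card R.V + 1) (Nat.card (T.V → R.V)), fun m g => ⟨?_, fun i p => ?_⟩⟩
      · exact (Fin.is_lt _).trans_le (le_max_right _ _)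
      · refine lt_of_lt_of_le ?_ (le_max_left _ _)
        split_ifs
        · exact Nat.succ_pos _
        · exact Nat.succ_lt_succ (Fin.is_lt _)
    sum_card_le := fun g => by
      refine (Finset.sum_congr rfl fun i _ => ?_).trans_le (toC g).sum_card_le
      congr 1
      ext p
      simp }

end Sprout

end FinTree

theorem theorem2 {k : Type u} [Field k] (d r : ℕ) :
    (∀ M : FinTreeᵒᵖ ⥤ ModuleCat.{u} k,
      CatModule.IsSmallish (fun x => x.unop.numEdges) d M →
      ∀ (T : FinTree) (v : Fin r → T.V), Function.Injective v →
      ∃ f : MvPolynomial (Fin r) ℚ, f.totalDegree ≤ d ∧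
        ∃ N : ℕ, ∀ m : Fin r → ℕ, (∀ i, N ≤ m i) →
          Module.Finite k (M.obj (Opposite.op (T.sprout v m))) ∧
          (Module.finrank k (M.obj (Opposite.op (T.sprout v m))) : ℚ) =
            MvPolynomial.eval (fun i => (m i : ℚ)) f) ∧
    (∀ M : RootedFinTreeᵒᵖ ⥤ ModuleCat.{u} k,
      CatModule.IsSmallish (fun x => x.unop.numEdges) d M →
      ∀ (T : RootedFinTree) (v : Fin r → T.tree.V), Function.Injective v →
      ∃ f : MvPolynomial (Fin r) ℚ, f.totalDegree ≤ d ∧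
        ∃ N : ℕ, ∀ m : Fin r → ℕ, (∀ i, N ≤ m i) →
          Module.Finite k (M.obj (Opposite.op (T.sprout v m))) ∧
          (Module.finrank k (M.obj (Opposite.op (T.sprout v m))) : ℚ) =
            MvPolynomial.eval (fun i => (m i : ℚ)) f) := by
  constructor
  · intro M hM T v _
    let c : ∀ {m m' : Fin r → ℕ}, (∀ i, Fin (m i) ↪o Fin (m' i)) →
        (Opposite.op (T.sprout v m) ⟶ Opposite.op (T.sprout v m')) := fun φ =>
      Quiver.Hom.op (V := FinTree) (T.sproutContraction v φ)
    obtain ⟨hfin, f, hf, N, hN⟩ := hM.eventuallyPolynomial (fun m => Opposite.op (T.sprout v m)) c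
      (fun x => T.wordModel v x.unop _ (fun g => g.unop) (fun h => Quiver.Hom.unop_inj h)
        (fun φ g => g ≫ c φ) fun φ g => rfl) fun x _ _ φ g => rfl
    exact ⟨f, hf, N, fun m hm => ⟨hfin m, hN m hm⟩⟩
  · intro M hM T v _
    let c : ∀ {m m' : Fin r → ℕ}, (∀ i, Fin (m i) ↪o Fin (m' i)) →
        (Opposite.op (T.sprout v m) ⟶ Opposite.op (T.sprout v m')) := fun φ =>
      Quiver.Hom.op (V := RootedFinTree) ⟨T.tree.sproutContraction v φ, rfl⟩
    obtain ⟨hfin, f, hf, N, hN⟩ := hM.eventuallyPolynomial (fun m => Opposite.op (T.sprout v m)) c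
      (fun x => T.tree.wordModel v x.unop.tree _ (fun g => g.unop.toContraction)
        (fun hgh => Quiver.Hom.unop_inj
          (RootedFinTree.Contraction.ext (congrArg FinTree.Contraction.toFun hgh)))
        (fun φ g => g ≫ c φ) fun φ g => rfl) fun x _ _ φ g => rfl
    exact ⟨f, hf, N, fun m hm => ⟨hfin m, hN m hm⟩⟩
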